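/- Let $\Omega:=\{(\alpha,\beta)\in\mathbb{R}^2:\alpha>0,\ \beta>\tfrac12,\ \alpha+\beta<1\}$. For an integer $j\ge 0$ put $$e_j(\alpha):=1-\left(\frac{\alpha^j-\alpha^{j+1}}{1+\alpha^j-\alpha^{j+1}}\right)^{\frac1{j+1}},$$ and let $\Delta$ be the set of all $(\alpha,\beta)\in\Omega$ such that $\beta<e_j(\alpha)$ for all $j\ge 0$. Write $[n]=\{1,\dots,n\}$ and let $\binom{[n]}{k}$ be the set of all $k$-element subsets of $[n]$. Families $\mathcal A\subset\binom{[n]}{k}$ and $\mathcal B\subset\binom{[n]}{l}$ are called cross-intersecting if $A\cap B\neq\emptyset$ for all $A\in\mathcal A$, $B\in\mathcal B$. Let $M(n,k,l)$ be the maximum of $|\mathcal A||\mathcal B|$ over all cross-intersecting families $\mathcal A\subset\binom{[n]}{k}$, $\mathcal B\subset\binom{[n]}{l}$. Let $(\alpha,\beta)\in\Delta$ be fixed. Then there exists $n_0=n_0(\alpha,\beta)$ such that for every $n>n_0$, with $k=\lfloor\alpha n\rfloor$ and $l=\lfloor\beta n\rfloor$, $$M(n,k,l)=\binom{n-1}{k-1}\binom{n-1}{l-1}.$$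 Moreover, if $n>n_0$ and $\mathcal A\subset\binom{[n]}{k}$, $\mathcal B\subset\binom{[n]}{l}$ are cross-intersecting families satisfying $|\mathcal A||\mathcal B|=\binom{n-1}{k-1}\binom{n-1}{l-1}$, then there is $i\in[n]$ such that $\mathcal A=\{A\in\binom{[n]}{k}:i\in A\}$ and $\mathcal B=\{B\in\binom{[n]}{l}:i\in B\}$. -/

import Mathlib

namespace CrossIntersecting

/-- The triangle `Ω` of pairs `(α, β)` with `α > 0`, `β > 1/2` and `α + β < 1`. -/
def Omega : Set (ℝ × ℝ) :=
  {p | 0 < p.1 ∧ 1 / 2 < p.2 ∧ p.1 + p.2 < 1}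

/-- `e_j(α) = 1 - ((α^j - α^(j+1)) / (1 + α^j - α^(j+1)))^(1/(j+1))`. -/
noncomputable def e (j : ℕ) (α : ℝ) : ℝ :=
  1 - ((α ^ j - α ^ (j + 1)) / (1 + α ^ j - α ^ (j + 1))) ^ ((1 : ℝ) / ((j : ℝ) + 1))

/-- The region `Δ` of all `(α, β) ∈ Ω` with `β < e_j(α)` for every `j ≥ 0`. -/
def Delta : Set (ℝ × ℝ) :=
  {p | p ∈ Omega ∧ ∀ j : ℕ, p.2 < e j p.1}

/-- `A` is a family of `k`-element subsets of an `n`-element set, `B` is a family of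
`l`-element subsets, and every member of `A` meets every member of `B`. -/
def IsCrossPair (n k l : ℕ) (A B : Finset (Finset (Fin n))) : Prop :=
  (∀ a ∈ A, a.card = k) ∧ (∀ b ∈ B, b.card = l) ∧ ∀ a ∈ A, ∀ b ∈ B, (a ∩ b).Nonempty

/-- The set of all products `|A| * |B|` over cross-intersecting families `A`, `B` of
`k`-subsets and `l`-subsets of an `n`-element set. -/
def crossProducts (n k l : ℕ) : Set ℕ :=
  {m | ∃ A B : Finset (Finset (Fin n)), IsCrossPair n k l A B ∧ m = A.card * B.card}

/-- The star centred at `i`: all `k`-element subsets containing `i`. -/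
def star (n k : ℕ) (i : Fin n) : Finset (Finset (Fin n)) :=
  {a ∈ Finset.powersetCard k (Finset.univ : Finset (Fin n)) | i ∈ a}

end CrossIntersecting

/-!
By the Kruskal–Katona theorem, cross-intersecting families of `k`-sets and `l`-sets with
`k + l ≤ n` may be replaced by initial segments, and then all members of one of the two families
contain the last point. Removing this point turns the sizes `(u, v)` into either
`(u, v - C(n-1, l-1))` or `(u - C(n-1, k-1), v)` for families on `n - 1` points.

If the first family is no larger than a star, one such step and the local LYM inequality give
`u / C(n-1, k-1) + v / C(n-1, l-1) ≤ 2`, and the arithmetic-geometric mean inequality concludes.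

If it is larger, suppose that the product is at least that of two stars for sizes with `k / n → α`
and `l / n → β`, and pass to limits along an ultrafilter. The possible limit densities form a set
covered by two affine images of itself, and iterating this covering bounds products of affine
functions on the set by their values at corners. The first step is necessarily of the second kind
and leaves the sets of the first family in excess of a star; by the inequalities which define `Δ`,
these bounds force all later steps to be of the first kind. After `m` of them the first family lives
among about `α ^ m * C(n, k)` sets and the second one among about `(1 - β) ^ m * C(n, l)`. Since
`α < 1 - β`, the LYM inequality contradicts the assumed size of the product for large `m`.
-/

namespace CrossIntersecting

open Finset
open scoped FinsetFamily

/-! ### Links and deletions -/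

/-- The members of `A` containing `v`, with `v` removed, as a family on the remaining `n` points;
these are numbered by `v.succAboveEmb`, so that induction on the size of the ground set applies. -/
def link {n : ℕ} (v : Fin (n + 1)) (A : Finset (Finset (Fin (n + 1)))) :
    Finset (Finset (Fin n)) :=
  {a | insert v (a.map v.succAboveEmb) ∈ A}

/-- The members of `A` avoiding `v`, as a family on the remaining `n` points, which are numbered as
for `link`. -/
def deletion {n : ℕ} (v : Fin (n + 1)) (A : Finset (Finset (Fin (n + 1)))) :
    Finset (Finset (Fin n)) :=
  {a | a.map v.succAboveEmb ∈ A}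

section Links

variable {n : ℕ} {v : Fin (n + 1)} {A : Finset (Finset (Fin (n + 1)))} {a : Finset (Fin n)}

@[simp] lemma mem_link : a ∈ link v A ↔ insert v (a.map v.succAboveEmb) ∈ A := by simp [link]

@[simp] lemma mem_deletion : a ∈ deletion v A ↔ a.map v.succAboveEmb ∈ A := by simp [deletion]

lemma notMem_map_succAboveEmb (v : Fin (n + 1)) (a : Finset (Fin n)) :
    v ∉ a.map v.succAboveEmb := by
  simp [Fin.succAbove_ne]

lemma exists_map_succAboveEmb_eq {s : Finset (Fin (n + 1))} (hs : v ∉ s) :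
    ∃ a : Finset (Fin n), a.map v.succAboveEmb = s := by
  have hsub : s ⊆ univ.map v.succAboveEmb := fun x hx => by
    obtain ⟨y, hy⟩ := Fin.exists_succAbove_eq (ne_of_mem_of_not_mem hx hs)
    exact mem_map.2 ⟨y, mem_univ _, hy⟩
  obtain ⟨a, -, ha⟩ := subset_map_iff.1 hsub
  exact ⟨a, ha.symm⟩

lemma map_link (v : Fin (n + 1)) (A : Finset (Finset (Fin (n + 1)))) :
    (link v A).map (mapEmbedding v.succAboveEmb).toEmbedding = A.memberSubfamily v := by
  ext s
  simp only [mem_map, mem_link, mem_memberSubfamily, RelEmbedding.coe_toEmbedding,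
    mapEmbedding_apply]
  constructor
  · rintro ⟨a, ha, rfl⟩
    exact ⟨ha, notMem_map_succAboveEmb v a⟩
  · rintro ⟨hs, hv⟩
    obtain ⟨a, rfl⟩ := exists_map_succAboveEmb_eq hv
    exact ⟨a, hs, rfl⟩

lemma map_deletion (v : Fin (n + 1)) (A : Finset (Finset (Fin (n + 1)))) :
    (deletion v A).map (mapEmbedding v.succAboveEmb).toEmbedding = A.nonMemberSubfamily v := by
  ext s
  simp only [mem_map, mem_deletion, mem_nonMemberSubfamily, RelEmbedding.coe_toEmbedding,
    mapEmbedding_apply]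
  constructor
  · rintro ⟨a, ha, rfl⟩
    exact ⟨ha, notMem_map_succAboveEmb v a⟩
  · rintro ⟨hs, hv⟩
    obtain ⟨a, rfl⟩ := exists_map_succAboveEmb_eq hv
    exact ⟨a, hs, rfl⟩

lemma card_link_add_card_deletion (v : Fin (n + 1)) (A : Finset (Finset (Fin (n + 1)))) :
    #(link v A) + #(deletion v A) = #A := by
  rw [← card_memberSubfamily_add_card_nonMemberSubfamily v, ← map_link, ← map_deletion, card_map,
    card_map]

lemma card_link (v : Fin (n + 1)) (A : Finset (Finset (Fin (n + 1)))) :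
    #(link v A) = #{a ∈ A | v ∈ a} := by
  have hdel : #(deletion v A) = #{a ∈ A | v ∉ a} := by
    rw [← card_map, map_deletion, nonMemberSubfamily]
  have hsum := card_link_add_card_deletion v A
  rw [hdel, ← card_filter_add_card_filter_not (s := A) (v ∈ ·)] at hsum
  exact Nat.add_right_cancel hsum

lemma mem_of_deletion_eq_empty (hdel : deletion v A = ∅) {s : Finset (Fin (n + 1))} (hs : s ∈ A) :
    v ∈ s := by
  by_contra hv
  obtain ⟨a, rfl⟩ := exists_map_succAboveEmb_eq hv
  have : a ∈ deletion v A := mem_deletion.2 hs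
  simp [hdel] at this

end Links

namespace IsCrossPair

variable {n k l : ℕ}

lemma symm {A B : Finset (Finset (Fin n))} (h : IsCrossPair n k l A B) : IsCrossPair n l k B A :=
  ⟨h.2.1, h.1, fun b hb a ha => inter_comm a b ▸ h.2.2 a ha b hb⟩

lemma card_left_le {A B : Finset (Finset (Fin n))} (h : IsCrossPair n k l A B) :
    #A ≤ n.choose k := by
  simpa using Set.Sized.card_le (𝒜 := A) (r := k) h.1

lemma card_right_le {A B : Finset (Finset (Fin n))} (h : IsCrossPair n k l A B) :
    #B ≤ n.choose l :=
  h.symm.card_left_le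

variable {A B : Finset (Finset (Fin (n + 1)))}

lemma link_deletion (h : IsCrossPair (n + 1) (k + 1) l A B) (v : Fin (n + 1)) :
    IsCrossPair n k l (link v A) (deletion v B) := by
  refine ⟨fun a ha => ?_, fun b hb => ?_, fun a ha b hb => ?_⟩
  · simpa [card_insert_of_notMem (notMem_map_succAboveEmb v a)] using h.1 _ (mem_link.1 ha)
  · simpa using h.2.1 _ (mem_deletion.1 hb)
  · have hab := h.2.2 _ (mem_link.1 ha) _ (mem_deletion.1 hb)
    rwa [insert_inter_of_notMem (notMem_map_succAboveEmb v b), ← map_inter, map_nonempty] at hab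

lemma deletion_link (h : IsCrossPair (n + 1) k (l + 1) A B) (v : Fin (n + 1)) :
    IsCrossPair n k l (deletion v A) (link v B) :=
  (h.symm.link_deletion v).symm

end IsCrossPair

/-! ### Shadows and initial segments -/

section Shadows

variable {α : Type*} [DecidableEq α] [Fintype α] {A B : Finset (Finset α)} {k l r : ℕ}

lemma disjoint_shadow_iterate_compls_iff (hA : (A : Set (Finset α)).Sized k)
    (hB : (B : Set (Finset α)).Sized l) (hkl : k + l ≤ Fintype.card α) :
    Disjoint A (∂^[Fintype.card α - l - k] Bᶜˢ) ↔ ∀ a ∈ A, ∀ b ∈ B, (a ∩ b).Nonempty := by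
  rw [disjoint_left]
  refine forall₂_congr fun a ha => ?_
  simp only [mem_shadow_iterate_iff_exists_mem_card_add, not_exists, not_and]
  constructor
  · intro h b hb
    by_contra hab
    rw [← not_disjoint_iff_nonempty_inter, not_not] at hab
    refine h bᶜ (by simpa using hb) (subset_compl_iff_disjoint_right.2 hab) ?_
    rw [card_compl, hB hb, hA ha]
    omega
  · intro h s hs has _
    obtain ⟨x, hx⟩ := h _ (mem_compls.1 hs)
    exact mem_compl.1 (mem_inter.1 hx).2 (has (mem_inter.1 hx).1)

lemma card_div_choose_le_card_shadow_iterate_div_choose (hA : (A : Set (Finset α)).Sized r) {m : ℕ}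
    (hm : m ≤ r) :
    (#A : ℝ) / (Fintype.card α).choose r ≤ #(∂^[m] A) / (Fintype.card α).choose (r - m) := by
  induction m with
  | zero => simp
  | succ m ih =>
    refine (ih (Nat.le_of_succ_le hm)).trans ?_
    rw [Function.iterate_succ_apply', ← Nat.sub_sub]
    exact card_div_choose_le_card_shadow_div_choose (by omega) hA.shadow_iterate

end Shadows

lemma exists_isInitSeg_card {α : Type*} [LinearOrder α] [Fintype α] {r m : ℕ}
    (hm : m ≤ (Fintype.card α).choose r) :
    ∃ 𝒞 : Finset (Finset α), Colex.IsInitSeg 𝒞 r ∧ #𝒞 = m := by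
  induction m with
  | zero => exact ⟨∅, Colex.isInitSeg_empty, rfl⟩
  | succ m ih =>
    obtain ⟨𝒞, h𝒞, hcard⟩ := ih (Nat.le_of_succ_le hm)
    have hne : (powersetCard r univ \ 𝒞).Nonempty := by
      rw [← card_pos]
      have := le_card_sdiff 𝒞 (powersetCard r univ)
      rw [card_powersetCard, card_univ] at this
      omega
    obtain ⟨s, hs, hmin⟩ := exists_min_image _ toColex hne
    simp only [mem_sdiff, mem_powersetCard_univ] at hs hmin
    refine ⟨insert s 𝒞, ⟨?_, ?_⟩, by rw [card_insert_of_notMem hs.2, hcard]⟩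
    · rw [coe_insert]
      rintro t (rfl | ht)
      exacts [hs.1, h𝒞.1 ht]
    · rintro t u ht ⟨hut, hu⟩
      rw [mem_insert] at ht ⊢
      by_contra! hcon
      rcases ht with rfl | ht
      · exact (hmin u ⟨hu, hcon.2⟩).not_gt hut
      · exact hcon.2 (h𝒞.2 ht ⟨hut, hu⟩)

lemma mem_of_isInitSeg_of_last_mem {n r : ℕ} {𝒞 : Finset (Finset (Fin (n + 1)))}
    (h𝒞 : Colex.IsInitSeg 𝒞 r) {s t : Finset (Fin (n + 1))} (hs : s ∈ 𝒞) (hlast : Fin.last n ∈ s)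
    (ht : #t = r) (hlast' : Fin.last n ∉ t) : t ∈ 𝒞 := by
  refine h𝒞.2 hs ⟨Colex.toColex_lt_toColex_iff_exists_forall_lt.2 ⟨_, hlast, hlast', ?_⟩, ht⟩
  exact fun b hb _ => (Fin.le_last b).lt_of_ne (ne_of_mem_of_not_mem hb hlast')

namespace IsCrossPair

variable {n k l : ℕ}

lemma exists_isInitSeg {A B : Finset (Finset (Fin n))} (h : IsCrossPair n k l A B)
    (hkl : k + l ≤ n) :
    ∃ A' B' : Finset (Finset (Fin n)), IsCrossPair n k l A' B' ∧
      Colex.IsInitSeg B'ᶜˢ (n - l) ∧ #A ≤ #A' ∧ #B' = #B := by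
  have hB : (Bᶜˢ : Set (Finset (Fin n))).Sized (n - l) := by
    simpa using Set.Sized.compls (𝒜 := B) h.2.1
  obtain ⟨𝒞, h𝒞, hcard⟩ := exists_isInitSeg_card (α := Fin n) (r := n - l) (m := #B) (by
    rw [Fintype.card_fin, Nat.choose_symm (by omega)]
    exact h.card_right_le)
  have hsized : (𝒞ᶜˢ : Set (Finset (Fin n))).Sized l := by
    simpa [Nat.sub_sub_self (show l ≤ n by omega)] using h𝒞.1.compls
  set 𝒮 := ∂^[n - l - k] 𝒞
  have hA' : ((powersetCard k univ \ 𝒮 : Finset (Finset (Fin n))) : Set (Finset (Fin n))).Sized k :=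
    fun a ha => mem_powersetCard_univ.1 (mem_sdiff.1 ha).1
  refine ⟨powersetCard k univ \ 𝒮, 𝒞ᶜˢ, ⟨hA', hsized, ?_⟩, by rwa [compls_compls], ?_,
    by rw [card_compls, hcard]⟩
  · rw [← disjoint_shadow_iterate_compls_iff hA' hsized (by simpa), compls_compls, Fintype.card_fin]
    exact sdiff_disjoint
  · have hdisj : Disjoint A (∂^[n - l - k] Bᶜˢ) := by
      simpa using (disjoint_shadow_iterate_compls_iff h.1 h.2.1 (by simpa)).2 h.2.2
    have hsub : A ⊆ powersetCard k univ \ ∂^[n - l - k] Bᶜˢ :=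
      subset_sdiff.2 ⟨fun a ha => mem_powersetCard_univ.2 (h.1 a ha), hdisj⟩
    have hsub' : ∂^[n - l - k] Bᶜˢ ⊆ powersetCard k univ := fun s hs => by
      rw [mem_powersetCard_univ, hB.shadow_iterate hs]
      omega
    calc #A ≤ #(powersetCard k univ) - #(∂^[n - l - k] Bᶜˢ) := by
          rw [← card_sdiff_of_subset hsub']
          exact card_le_card hsub
      _ ≤ #(powersetCard k univ) - #𝒮 :=
          Nat.sub_le_sub_left (iterated_kk hB (by rw [hcard, card_compls]) h𝒞) _
      _ ≤ #(powersetCard k univ \ 𝒮) := le_card_sdiff _ _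

/-- If the complements of `B` form an initial segment, then either some of them contains the last
point, so that all `(n - l)`-sets avoiding it are complements of `B` and no member of `A` fits into
them, or `B` is contained in the star of the last point. -/
lemma deletion_last_eq_empty {A B : Finset (Finset (Fin (n + 1)))}
    (h : IsCrossPair (n + 1) k (l + 1) A B) (hB : Colex.IsInitSeg Bᶜˢ (n - l)) (hkl : k + l ≤ n) :
    deletion (Fin.last n) A = ∅ ∨ deletion (Fin.last n) B = ∅ := by
  simp only [eq_empty_iff_forall_notMem, mem_deletion]
  by_contra! hcon
  obtain ⟨⟨a, ha⟩, b, hb⟩ := hcon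
  obtain ⟨t, hat, -, ht⟩ := exists_subsuperset_card_eq (n := n - l) (subset_univ a)
    (by have := h.1 _ ha; rw [card_map] at this; omega) (by simp)
  have htB : t.map (Fin.last n).succAboveEmb ∈ Bᶜˢ :=
    mem_of_isInitSeg_of_last_mem hB (compl_mem_compls hb)
      (mem_compl.2 (notMem_map_succAboveEmb _ _)) (by rwa [card_map]) (notMem_map_succAboveEmb _ _)
  have hdisj := (h.2.2 _ ha _ (mem_compls.1 htB))
  rw [← not_disjoint_iff_nonempty_inter] at hdisj
  exact hdisj (disjoint_compl_right.mono_left (map_subset_map.2 hat))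

end IsCrossPair

/-! ### Feasible sizes -/

/-- There are cross-intersecting families of `k`-sets and `l`-sets on `n` points with at least `u`
and `v` members respectively. All size estimates are recursions in this predicate, and asking for
lower bounds makes it monotone. -/
def Feasible (n k l u v : ℕ) : Prop :=
  ∃ A B : Finset (Finset (Fin n)), IsCrossPair n k l A B ∧ u ≤ #A ∧ v ≤ #B

lemma IsCrossPair.feasible {n k l : ℕ} {A B : Finset (Finset (Fin n))}
    (h : IsCrossPair n k l A B) : Feasible n k l #A #B :=
  ⟨A, B, h, le_rfl, le_rfl⟩

namespace Feasible

variable {n k l u v : ℕ}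

lemma symm (h : Feasible n k l u v) : Feasible n l k v u := by
  obtain ⟨A, B, hAB, hu, hv⟩ := h
  exact ⟨B, A, hAB.symm, hv, hu⟩

lemma left_le (h : Feasible n k l u v) : u ≤ n.choose k := by
  obtain ⟨A, B, hAB, hu, -⟩ := h
  exact hu.trans hAB.card_left_le

lemma right_le (h : Feasible n k l u v) : v ≤ n.choose l := h.symm.left_le

theorem split (h : Feasible (n + 1) (k + 1) (l + 1) u v) (hkl : k + l + 1 ≤ n) :
    Feasible n k (l + 1) u (v - n.choose l) ∨ Feasible n (k + 1) l (u - n.choose k) v := by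
  obtain ⟨A₀, B₀, h₀, hu, hv⟩ := h
  obtain ⟨A, B, hAB, hB, hA₀, hB₀⟩ := h₀.exists_isInitSeg (by omega)
  have hA_card := card_link_add_card_deletion (Fin.last n) A
  have hB_card := card_link_add_card_deletion (Fin.last n) B
  have hlink := hAB.link_deletion (Fin.last n)
  have hdel := hAB.deletion_link (Fin.last n)
  rcases hAB.deletion_last_eq_empty (by simpa using hB) (by omega) with h0 | h0
  · left
    rw [h0, card_empty] at hA_card
    have := hdel.card_right_le
    exact ⟨_, _, hlink, by omega, by omega⟩
  · right
    rw [h0, card_empty] at hB_card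
    have := hlink.card_left_le
    exact ⟨_, _, hdel, by omega, by omega⟩

lemma split_pred (h : Feasible n k l u v) (hk : 0 < k) (hl : 0 < l) (hkl : k + l ≤ n) :
    Feasible (n - 1) (k - 1) l u (v - (n - 1).choose (l - 1)) ∨
      Feasible (n - 1) k (l - 1) (u - (n - 1).choose (k - 1)) v := by
  obtain ⟨k, rfl⟩ := Nat.exists_eq_add_one.2 hk
  obtain ⟨l, rfl⟩ := Nat.exists_eq_add_one.2 hl
  obtain ⟨n, rfl⟩ := Nat.exists_eq_add_one.2 (show 0 < n by omega)
  exact h.split (by omega)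

lemma pos_left (h : Feasible n k l u v) (hu : 0 < u) (hv : 0 < v) : 0 < k := by
  obtain ⟨A, B, hAB, hA, hB⟩ := h
  obtain ⟨a, ha⟩ := card_pos.1 (hu.trans_le hA)
  obtain ⟨b, hb⟩ := card_pos.1 (hv.trans_le hB)
  rw [← hAB.1 a ha, card_pos]
  exact (hAB.2.2 a ha b hb).mono inter_subset_left

/-- By the local LYM inequality, the sets which the first family has to avoid are at least as dense
as the second family. -/
theorem div_choose_add_div_choose_le_one (h : Feasible n k l u v) (hkl : k + l ≤ n) :
    (u : ℝ) / n.choose k + v / n.choose l ≤ 1 := by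
  obtain ⟨A, B, hAB, hu, hv⟩ := h
  have hB : (Bᶜˢ : Set (Finset (Fin n))).Sized (n - l) := by
    simpa using Set.Sized.compls (𝒜 := B) hAB.2.1
  have hS := hB.shadow_iterate (k := n - l - k)
  have hLYM := card_div_choose_le_card_shadow_iterate_div_choose hB (m := n - l - k) (by omega)
  rw [show n - l - (n - l - k) = k by omega] at hS hLYM
  rw [card_compls, Fintype.card_fin, Nat.choose_symm (by omega : l ≤ n)] at hLYM
  have hdisj : Disjoint A (∂^[n - l - k] Bᶜˢ) := by
    simpa using (disjoint_shadow_iterate_compls_iff hAB.1 hAB.2.1 (by simpa)).2 hAB.2.2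
  have hcard : u + #(∂^[n - l - k] Bᶜˢ) ≤ n.choose k := by
    have hunion : (↑(A ∪ ∂^[n - l - k] Bᶜˢ) : Set (Finset (Fin n))).Sized k := by
      rw [coe_union]
      exact Set.sized_union.2 ⟨hAB.1, hS⟩
    have := hunion.card_le
    rw [card_union_of_disjoint hdisj, Fintype.card_fin] at this
    omega
  calc (u : ℝ) / n.choose k + v / n.choose l
      ≤ u / n.choose k + #(∂^[n - l - k] Bᶜˢ) / n.choose k := by
        have hvB : (v : ℝ) / n.choose l ≤ #B / n.choose l := by gcongr
        linarith
    _ = ((u + #(∂^[n - l - k] Bᶜˢ) : ℕ) : ℝ) / n.choose k := by push_cast; ring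
    _ ≤ 1 := div_le_one_of_le₀ (by exact_mod_cast hcard) (by positivity)

lemma mul_choose_add_mul_choose_le (h : Feasible n k l u v) (hkl : k + l ≤ n) :
    u * n.choose l + v * n.choose k ≤ n.choose k * n.choose l := by
  have hk : 0 < n.choose k := Nat.choose_pos (by omega)
  have hl : 0 < n.choose l := Nat.choose_pos (by omega)
  have hle := h.div_choose_add_div_choose_le_one hkl
  rw [div_add_div _ _ (by positivity) (by positivity), div_le_one (by positivity),
    mul_comm (n.choose k : ℝ) v] at hle
  exact_mod_cast hle

end Feasible

lemma choose_mul_choose_lt {n k l : ℕ} (h : k + l + 1 < n) :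
    n.choose k * n.choose l < n.choose (k + 1) * n.choose (l + 1) := by
  refine Nat.lt_of_mul_lt_mul_right (a := (k + 1) * (l + 1)) ?_
  calc n.choose k * n.choose l * ((k + 1) * (l + 1))
      < n.choose k * n.choose l * ((n - l) * (n - k)) :=
        Nat.mul_lt_mul_of_pos_left (Nat.mul_lt_mul'' (by omega) (by omega))
          (Nat.mul_pos (Nat.choose_pos (by omega)) (Nat.choose_pos (by omega)))
    _ = (n.choose k * (n - k)) * (n.choose l * (n - l)) := by ring
    _ = (n.choose (k + 1) * (k + 1)) * (n.choose (l + 1) * (l + 1)) := by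
        rw [Nat.choose_succ_right_eq, Nat.choose_succ_right_eq]
    _ = n.choose (k + 1) * n.choose (l + 1) * ((k + 1) * (l + 1)) := by ring

lemma mul_add_add_mul_add_lt {P P' Q Q' u v w : ℕ} (hPQ : P * Q < P' * Q')
    (hw : u * Q' + w * P ≤ P * Q') (hv : v ≤ Q + w) (hu : 0 < u) :
    u * (Q + Q') + v * (P + P') < (P + P') * (Q + Q') := by
  have hPQu : u * (P * Q) < u * (P' * Q') := Nat.mul_lt_mul_of_pos_left hPQ hu
  have hwP := Nat.mul_le_mul_right (P + P') hw
  have hvP := Nat.mul_le_mul_right (P * (P + P')) hv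
  refine Nat.lt_of_mul_lt_mul_left (a := P) ?_
  linarith

theorem Feasible.mul_choose_add_mul_choose_lt {n k l u v : ℕ} (h : Feasible n k l u v)
    (hkl : k + l < n) (hu : 0 < u) (hv : 0 < v) :
    u * n.choose l + v * n.choose k < n.choose k * n.choose l := by
  obtain ⟨k, rfl⟩ := Nat.exists_eq_add_one.2 (h.pos_left hu hv)
  obtain ⟨l, rfl⟩ := Nat.exists_eq_add_one.2 (h.symm.pos_left hv hu)
  obtain ⟨n, rfl⟩ := Nat.exists_eq_add_one.2 (show 0 < n by omega)
  rw [Nat.choose_succ_succ', Nat.choose_succ_succ']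
  rcases h.split (by omega) with h' | h'
  · exact mul_add_add_mul_add_lt (choose_mul_choose_lt (by omega))
      (h'.mul_choose_add_mul_choose_le (by omega)) (by omega) hu
  · have := mul_add_add_mul_add_lt (v := u) (choose_mul_choose_lt (k := l) (l := k) (by omega))
      (h'.symm.mul_choose_add_mul_choose_le (by omega)) (by omega) hv
    linarith

/-! ### First families no larger than a star -/

lemma choose_succ_le_choose {n l : ℕ} (h : n ≤ 2 * l + 1) : n.choose (l + 1) ≤ n.choose l := by
  refine Nat.le_of_mul_le_mul_right (c := l + 1) ?_ l.succ_pos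
  rw [Nat.choose_succ_right_eq]
  exact Nat.mul_le_mul_left _ (by omega)

theorem Feasible.mul_choose_add_mul_choose_le_two_mul {n k l u v : ℕ}
    (h : Feasible (n + 1) (k + 1) (l + 1) u v) (hkl : k + l + 1 ≤ n) (hl : n ≤ 2 * l + 1)
    (hu : u ≤ n.choose k) :
    u * n.choose l + v * n.choose k ≤ 2 * (n.choose k * n.choose l) := by
  have huT : u * n.choose l ≤ n.choose k * n.choose l := Nat.mul_le_mul_right _ hu
  rcases h.split hkl with h' | h'
  · have hchord := h'.mul_choose_add_mul_choose_le (by omega)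
    have hT := choose_succ_le_choose hl
    have hv : v ≤ n.choose l + (v - n.choose l) := by omega
    generalize v - n.choose l = w at *
    nlinarith
  · have := Nat.mul_le_mul_right (n.choose k) h'.right_le
    linarith

lemma mul_le_sq_of_add_le_two_mul {x y z : ℕ} (h : x + y ≤ 2 * z) : x * y ≤ z ^ 2 := by
  zify at *
  nlinarith [sq_nonneg ((x : ℤ) - y)]

lemma eq_of_mul_eq_sq_of_add_le_two_mul {x y z : ℕ} (h : x + y ≤ 2 * z) (hxy : x * y = z ^ 2) :
    x = z ∧ y = z := by
  have hsub : (x : ℤ) - y = 0 := by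
    zify at *
    nlinarith [sq_nonneg ((x : ℤ) - y)]
  obtain rfl : x = y := by omega
  have : x = z := by nlinarith
  exact ⟨this, this⟩

theorem Feasible.mul_le_of_left_le {n k l u v : ℕ} (h : Feasible (n + 1) (k + 1) (l + 1) u v)
    (hkl : k + l + 1 ≤ n) (hl : n ≤ 2 * l + 1) (hu : u ≤ n.choose k) :
    u * v ≤ n.choose k * n.choose l ∧
      (u * v = n.choose k * n.choose l → u = n.choose k ∧ v = n.choose l) := by
  have hS : 0 < n.choose k := Nat.choose_pos (by omega)
  have hT : 0 < n.choose l := Nat.choose_pos (by omega)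
  have hadd := h.mul_choose_add_mul_choose_le_two_mul hkl hl hu
  generalize n.choose k = S at *
  generalize n.choose l = T at *
  have hprod : (u * T) * (v * S) = u * v * (S * T) := by ring
  constructor
  · refine Nat.le_of_mul_le_mul_right (c := S * T) ?_ (by positivity)
    rw [← hprod, ← sq]
    exact mul_le_sq_of_add_le_two_mul hadd
  · intro heq
    obtain ⟨huT, hvS⟩ := eq_of_mul_eq_sq_of_add_le_two_mul hadd (by rw [hprod, heq, sq])
    rw [mul_comm S T] at hvS
    exact ⟨Nat.eq_of_mul_eq_mul_right hT huT, Nat.eq_of_mul_eq_mul_right hS hvS⟩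

/-! ### Stars -/

section Stars

variable {n k l : ℕ}

lemma deletion_star (n k : ℕ) (i : Fin (n + 1)) : deletion i (star (n + 1) k i) = ∅ :=
  eq_empty_of_forall_notMem fun a ha =>
    notMem_map_succAboveEmb i a (mem_filter.1 (mem_deletion.1 ha)).2

lemma link_star (n k : ℕ) (i : Fin (n + 1)) :
    link i (star (n + 1) (k + 1) i) = powersetCard k univ := by
  ext a
  simp [star, card_insert_of_notMem (notMem_map_succAboveEmb i a)]

lemma card_star (n k : ℕ) (i : Fin (n + 1)) : #(star (n + 1) (k + 1) i) = n.choose k := by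
  simp [← card_link_add_card_deletion i, deletion_star, link_star]

lemma isCrossPair_star (n k l : ℕ) (i : Fin n) :
    IsCrossPair n k l (star n k i) (star n l i) := by
  simp only [IsCrossPair, star, mem_filter, mem_powersetCard_univ]
  exact ⟨fun _ ha => ha.1, fun _ hb => hb.1, fun _ ha _ hb => ⟨i, mem_inter.2 ⟨ha.2, hb.2⟩⟩⟩

lemma eq_star_of_deletion_eq_empty {A : Finset (Finset (Fin (n + 1)))} {i : Fin (n + 1)}
    (hA : ∀ a ∈ A, #a = k + 1) (hcard : #A = n.choose k) (hdel : deletion i A = ∅) :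
    A = star (n + 1) (k + 1) i :=
  eq_of_subset_of_card_le
    (fun a ha => mem_filter.2
      ⟨mem_powersetCard_univ.2 (hA a ha), mem_of_deletion_eq_empty hdel ha⟩)
    (by rw [card_star, hcard])

lemma exists_lt_card_link {B : Finset (Finset (Fin (n + 1)))} (hB : ∀ b ∈ B, #b = l) {m : ℕ}
    (hm : (n + 1) * m < l * #B) : ∃ v, m < #(link v B) := by
  by_contra! hle
  have hsum := sum_card_le (B := B) fun v => (card_link v B).symm.trans_le (hle v)
  rw [sum_const_nat hB, Fintype.card_fin] at hsum
  linarith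

lemma add_two_mul_choose_lt (hln : l < n) :
    (n + 2) * n.choose l < (l + 2) * (n + 1).choose (l + 1) := by
  have hpos : 0 < n.choose (l + 1) := Nat.choose_pos hln
  have hsucc := Nat.add_one_mul_choose_eq n l
  have hpascal := Nat.choose_succ_succ' n l
  linarith

theorem IsCrossPair.deletion_eq_empty_of_lt_card_link {A B : Finset (Finset (Fin (n + 2)))}
    {i : Fin (n + 2)} (h : IsCrossPair (n + 2) (k + 2) (l + 2) A B) (hkl : k + l + 2 < n)
    (hA : #A = (n + 1).choose (k + 1)) (hB : #B = (n + 1).choose (l + 1))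
    (hi : n.choose l < #(link i B)) : deletion i A = ∅ ∧ deletion i B = ∅ := by
  have hS : 0 < n.choose (k + 1) := Nat.choose_pos (by omega)
  rw [← card_link_add_card_deletion i, Nat.choose_succ_succ'] at hA hB
  have hfeas : Feasible n (k + 1) (l + 1) #(deletion i A) (#(link i B) - n.choose l) :=
    ((h.deletion_link i).feasible.split (by omega)).resolve_right
      fun h' => hi.not_ge h'.right_le
  have hchord : (#(link i A) - n.choose k) * n.choose (l + 1) +
      #(deletion i B) * n.choose (k + 1) ≤ n.choose (k + 1) * n.choose (l + 1) := by
    rcases (h.link_deletion i).feasible.split (by omega) with h' | h'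
    · rw [Nat.sub_eq_zero_of_le h'.left_le, zero_mul, zero_add, mul_comm]
      exact Nat.mul_le_mul_left _ (by omega)
    · exact h'.mul_choose_add_mul_choose_le (by omega)
  obtain ⟨x, hx⟩ : ∃ x, x = #(link i A) - n.choose k := ⟨_, rfl⟩
  obtain ⟨y, hy⟩ : ∃ y, y = #(link i B) - n.choose l := ⟨_, rfl⟩
  rw [← hx] at hchord
  rw [← hy] at hfeas
  have hxA : n.choose (k + 1) ≤ #(deletion i A) + x := by omega
  have hyB : #(deletion i B) + y = n.choose (l + 1) := by omega
  have hA₀ : #(deletion i A) = 0 := by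
    by_contra hne
    have := hfeas.mul_choose_add_mul_choose_lt (by omega) (Nat.pos_of_ne_zero hne) (by omega)
    nlinarith
  have hB₀ : #(deletion i B) = 0 := by
    rw [hA₀, zero_add] at hxA
    nlinarith
  exact ⟨card_eq_zero.1 hA₀, card_eq_zero.1 hB₀⟩

/-- Averaging over the points gives a point whose link in `B` is too large for the families to have
any member avoiding it. -/
theorem IsCrossPair.eq_star {A B : Finset (Finset (Fin (n + 2)))}
    (h : IsCrossPair (n + 2) (k + 2) (l + 2) A B) (hkl : k + l + 2 < n)
    (hA : #A = (n + 1).choose (k + 1)) (hB : #B = (n + 1).choose (l + 1)) :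
    ∃ i, A = star (n + 2) (k + 2) i ∧ B = star (n + 2) (l + 2) i := by
  obtain ⟨i, hi⟩ := exists_lt_card_link h.2.1 (hB ▸ add_two_mul_choose_lt (show l < n by omega))
  obtain ⟨hA₀, hB₀⟩ := h.deletion_eq_empty_of_lt_card_link hkl hA hB hi
  exact ⟨i, eq_star_of_deletion_eq_empty h.1 hA hA₀, eq_star_of_deletion_eq_empty h.2.1 hB hB₀⟩

theorem isGreatest_crossProducts_and_eq_star (hk : 2 ≤ k) (hl : 2 ≤ l) (hkl : k + l < n)
    (hn : n < 2 * l)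
    (hlarge : ∀ u v, Feasible n k l u v → (n - 1).choose (k - 1) < u →
      u * v < (n - 1).choose (k - 1) * (n - 1).choose (l - 1)) :
    IsGreatest (crossProducts n k l) ((n - 1).choose (k - 1) * (n - 1).choose (l - 1)) ∧
      ∀ A B : Finset (Finset (Fin n)), IsCrossPair n k l A B →
        #A * #B = (n - 1).choose (k - 1) * (n - 1).choose (l - 1) →
        ∃ i, A = star n k i ∧ B = star n l i := by
  obtain ⟨k, rfl⟩ := Nat.exists_eq_add_of_le' hk
  obtain ⟨l, rfl⟩ := Nat.exists_eq_add_of_le' hl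
  obtain ⟨n, rfl⟩ := Nat.exists_eq_add_of_le' (show 2 ≤ n by omega)
  have hsmall {u v : ℕ} (h : Feasible (n + 2) (k + 2) (l + 2) u v)
      (hu : u ≤ (n + 1).choose (k + 1)) :=
    h.mul_le_of_left_le (by omega) (by omega) hu
  refine ⟨⟨⟨_, _, isCrossPair_star _ _ _ 0, by rw [card_star, card_star]; rfl⟩, ?_⟩, ?_⟩
  · rintro _ ⟨A, B, h, rfl⟩
    exact (le_or_gt #A _).elim (fun hA => (hsmall h.feasible hA).1)
      fun hA => (hlarge _ _ h.feasible hA).le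
  · intro A B h heq
    have hA := not_lt.1 fun hA => (hlarge _ _ h.feasible hA).ne heq
    obtain ⟨hA, hB⟩ := (hsmall h.feasible hA).2 heq
    exact h.eq_star (by omega) hA hB

end Stars

end CrossIntersecting

namespace CrossIntersecting

open Filter Topology

/-! ### The limit problem -/

/-- A set of pairs of densities below the line `a + b = 1` which is covered by the down-closures of
its images under the affine maps `(a, b) ↦ (α a, β + (1 - β) b)` and
`(a, b) ↦ (α + (1 - α) a, β b)`; this is what remains of `Feasible.split` in the limit. -/
structure IsSelfSimilar (α β : ℝ) (Γ : Set (ℝ × ℝ)) : Prop where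
  nonneg_left : ∀ p ∈ Γ, 0 ≤ p.1
  nonneg_right : ∀ p ∈ Γ, 0 ≤ p.2
  add_le_one : ∀ p ∈ Γ, p.1 + p.2 ≤ 1
  cover : ∀ p ∈ Γ, ∃ p' ∈ Γ, (p.1 ≤ α * p'.1 ∧ p.2 ≤ β + (1 - β) * p'.2) ∨
    (p.1 ≤ α + (1 - α) * p'.1 ∧ p.2 ≤ β * p'.2)

namespace IsSelfSimilar

variable {α β x a z c : ℝ} {Γ : Set (ℝ × ℝ)} {p : ℝ × ℝ}

lemma exists_mul_le (hΓ : IsSelfSimilar α β Γ) (hx : 0 ≤ x) (ha : 0 ≤ a) (hz : 0 ≤ z) (hc : 0 ≤ c)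
    (hp : p ∈ Γ) :
    ∃ p' ∈ Γ,
      (x + a * p.1) * (z + c * p.2) ≤
        (x + a * α * p'.1) * (z + c * β + c * (1 - β) * p'.2) ∨
      (x + a * p.1) * (z + c * p.2) ≤
        (x + a * α + a * (1 - α) * p'.1) * (z + c * β * p'.2) := by
  have h1 := hΓ.nonneg_left p hp
  have h2 := hΓ.nonneg_right p hp
  obtain ⟨p', hp', ⟨hl, hr⟩ | ⟨hl, hr⟩⟩ := hΓ.cover p hp
  · refine ⟨p', hp', .inl ?_⟩
    calc (x + a * p.1) * (z + c * p.2)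
        ≤ (x + a * (α * p'.1)) * (z + c * (β + (1 - β) * p'.2)) := by
          gcongr
          exact add_nonneg hx (mul_nonneg ha (h1.trans hl))
      _ = _ := by ring
  · refine ⟨p', hp', .inr ?_⟩
    calc (x + a * p.1) * (z + c * p.2)
        ≤ (x + a * (α + (1 - α) * p'.1)) * (z + c * (β * p'.2)) := by
          gcongr
          exact add_nonneg hx (mul_nonneg ha (h1.trans hl))
      _ = _ := by ring

lemma mul_le_of_mul_le_mul (hΓ : IsSelfSimilar α β Γ) (hx : 0 ≤ x) (ha : 0 ≤ a) (hc : 0 ≤ c)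
    (h : a * (z + c) ≤ x * c) (hp : p ∈ Γ) :
    (x + a * p.1) * (z + c * p.2) ≤ x * (z + c) := by
  have h1 := hΓ.nonneg_left p hp
  have h2 := hΓ.add_le_one p hp
  calc (x + a * p.1) * (z + c * p.2) ≤ (x + a * p.1) * (z + c * (1 - p.1)) := by
        gcongr
        linarith
    _ = x * (z + c) + p.1 * (a * (z + c) - x * c) - a * c * p.1 ^ 2 := by ring
    _ ≤ x * (z + c) := by
        have := mul_nonpos_of_nonneg_of_nonpos h1 (sub_nonpos.2 h)
        have := mul_nonneg (mul_nonneg ha hc) (sq_nonneg p.1)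
        linarith

/-- `(α, β)` is the point where the two affine images of the segment from `(0, 1)` to `(1, 0)`
meet. -/
lemma middle_le_max (hα : 0 ≤ α) (hβ : 0 ≤ β) (hαβ : α + β ≤ 1) (hc : 0 ≤ c)
    (h : a * (α * β) ≤ (1 - α - β) * x) :
    (x + a * α) * (z + c * β) ≤ max (x * (z + c)) ((x + a) * z) := by
  have hδ : 0 ≤ 1 - α - β := by linarith
  have hac : a * c * (α * β) ≤ (1 - α - β) * (x * c) := by
    linarith [mul_le_mul_of_nonneg_right h hc]
  rw [le_max_iff]
  rcases le_total (a * z) (x * c) with hle | hle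
  · left
    linarith [mul_le_mul_of_nonneg_left hle hα]
  · right
    linarith [mul_le_mul_of_nonneg_left hle hβ, mul_le_mul_of_nonneg_left hle hδ]

lemma mul_le_max_add (hΓ : IsSelfSimilar α β Γ) (hα : 0 ≤ α) (hβ : 0 ≤ β) (hαβ : α + β ≤ 1)
    (r : ℕ) (hx : 0 ≤ x) (ha : 0 ≤ a) (hz : 0 ≤ z) (hc : 0 ≤ c)
    (h : a * (α * β) ≤ (1 - α - β) * x) (hp : p ∈ Γ) :
    (x + a * p.1) * (z + c * p.2) ≤
      max (x * (z + c)) ((x + a) * z) + max α (1 - α) ^ r * (a * (z + c)) := by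
  have hα₁ : 0 ≤ 1 - α := by linarith
  have hβ₁ : 0 ≤ 1 - β := by linarith
  have hδ : 0 ≤ 1 - α - β := by linarith
  have : 0 ≤ max α (1 - α) := le_max_of_le_left hα
  induction r generalizing x a z c p with
  | zero =>
    have h1 := hΓ.nonneg_left p hp
    have h2 := hΓ.nonneg_right p hp
    have h12 := hΓ.add_le_one p hp
    calc (x + a * p.1) * (z + c * p.2) ≤ (x + a * 1) * (z + c * 1) := by gcongr <;> linarith
      _ = x * (z + c) + max α (1 - α) ^ 0 * (a * (z + c)) := by ring
      _ ≤ _ := by gcongr; exact le_max_left _ _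
  | succ r ih =>
    have hmid := middle_le_max (z := z) hα hβ hαβ hc h
    have herr {t s : ℝ} (_ : 0 ≤ t) (ht' : t ≤ max α (1 - α)) (hs : 0 ≤ s) (hs' : s ≤ z + c) :
        max α (1 - α) ^ r * (a * t * s) ≤ max α (1 - α) ^ (r + 1) * (a * (z + c)) := by
      calc max α (1 - α) ^ r * (a * t * s)
          ≤ max α (1 - α) ^ r * (a * max α (1 - α) * (z + c)) := by gcongr
        _ = max α (1 - α) ^ (r + 1) * (a * (z + c)) := by ring
    obtain ⟨p', hp', hle | hle⟩ := hΓ.exists_mul_le hx ha hz hc hp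
    · have hrec := ih (x := x) (a := a * α) (z := z + c * β) (c := c * (1 - β)) hx (by positivity)
        (by positivity) (by positivity) (by nlinarith [mul_nonneg ha (mul_nonneg hα hβ)]) hp'
      rw [show z + c * β + c * (1 - β) = z + c by ring] at hrec
      exact hle.trans (hrec.trans (add_le_add (max_le (le_max_left _ _) hmid)
        (herr hα (le_max_left _ _) (by positivity) le_rfl)))
    · have hrec := ih (x := x + a * α) (a := a * (1 - α)) (z := z) (c := c * β) (by positivity)
        (by positivity) hz (by positivity)
        (by nlinarith [mul_nonneg ha (mul_nonneg hα hβ), mul_nonneg ha (mul_nonneg hα hδ)]) hp'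
      rw [show x + a * α + a * (1 - α) = x + a by ring] at hrec
      exact hle.trans (hrec.trans (add_le_add (max_le hmid (le_max_right _ _))
        (herr hα₁ (le_max_right _ _) (by positivity) (by nlinarith [mul_nonneg hc hβ₁]))))

lemma le_max (hΓ : IsSelfSimilar α β Γ) (hα : 0 < α) (hβ : 0 < β) (hαβ : α + β < 1)
    (hx : 0 ≤ x) (ha : 0 ≤ a) (hz : 0 ≤ z) (hc : 0 ≤ c)
    (h : a * (α * β) ≤ (1 - α - β) * x) (hp : p ∈ Γ) :
    (x + a * p.1) * (z + c * p.2) ≤ max (x * (z + c)) ((x + a) * z) := by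
  have hρ : Tendsto (fun r : ℕ => max α (1 - α) ^ r) atTop (𝓝 0) :=
    tendsto_pow_atTop_nhds_zero_of_lt_one (le_max_of_le_left hα.le)
      (max_lt (by linarith) (by linarith))
  have hlim := (hρ.mul_const (a * (z + c))).const_add (max (x * (z + c)) ((x + a) * z))
  rw [zero_mul, add_zero] at hlim
  exact ge_of_tendsto' hlim fun r => hΓ.mul_le_max_add hα.le hβ.le hαβ.le r hx ha hz hc h hp

/-- After one splitting step both pieces lie in the range of `le_max`. -/
lemma le_max_of_middle_le (hΓ : IsSelfSimilar α β Γ) (hα : 0 < α) (hβ : 0 < β) (hαβ : α + β < 1)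
    (h₀ : β * (2 - α) < 1) (hx : 0 ≤ x) (hz : 0 ≤ z)
    (hlow : α * (1 - β) * (1 - α) ≤ (1 - α - β) * x)
    (hmid : (x + (1 - α) * α) * (z + β * β) ≤ x * (z + β)) (hp : p ∈ Γ) :
    (x + (1 - α) * p.1) * (z + β * p.2) ≤ max (x * (z + β)) ((x + (1 - α)) * z) := by
  have hα₁ : 0 < 1 - α := by linarith
  have hβ₁ : 0 < 1 - β := by linarith
  have hγ : 0 < α * (1 - α) := by positivity
  have hαβ₁ : α * β ≤ 1 - β := by nlinarith [mul_pos hα hβ₁]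
  obtain ⟨p', hp', hle | hle⟩ := hΓ.exists_mul_le hx hα₁.le hz hβ.le hp
  · have hL := hΓ.le_max (x := x) (a := (1 - α) * α) (z := z + β * β) (c := β * (1 - β))
      hα hβ hαβ hx (by positivity) (by positivity) (by positivity)
      (by linarith [mul_le_mul_of_nonneg_left hαβ₁ hγ.le]) hp'
    rw [show z + β * β + β * (1 - β) = z + β by ring] at hL
    exact hle.trans (hL.trans (max_le (le_max_left _ _) (le_max_of_le_left hmid)))
  · have hR := hΓ.le_max (x := x + (1 - α) * α) (a := (1 - α) * (1 - α)) (z := z) (c := β * β)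
      hα hβ hαβ (by positivity) (by positivity) hz (by positivity)
      (by linarith [mul_pos hγ (show 0 < 2 - α - 3 * β + α * β by linarith)]) hp'
    rw [show x + (1 - α) * α + (1 - α) * (1 - α) = x + (1 - α) by ring] at hR
    exact hle.trans (hR.trans (max_le (le_max_of_le_left hmid) (le_max_right _ _)))

lemma right_le_max (hΓ : IsSelfSimilar α β Γ) (hα : 0 < α) (hβ : 1 / 2 < β) (hαβ : α + β < 1)
    (h₀ : β * (2 - α) < 1) (hz : 0 ≤ z) (hx : α * (z + 1) ≤ (1 - β) * x) (hp : p ∈ Γ) :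
    (x + (1 - α) * p.1) * (z + β * p.2) ≤ max (x * (z + β)) ((x + (1 - α)) * z) := by
  have hβ₀ : 0 < β := by linarith
  have hα₁ : 0 < 1 - α := by linarith
  have hβ₁ : 0 < 1 - β := by linarith
  have hx₀ : 0 ≤ x := nonneg_of_mul_nonneg_right (hx.trans' (by positivity)) hβ₁
  rcases le_or_gt ((1 - α) * (z + β)) (x * β) with hA | hA
  · exact le_max_of_le_left (hΓ.mul_le_of_mul_le_mul hx₀ hα₁.le hβ₀.le hA hp)
  rcases le_or_gt ((1 - α) * (α * β)) ((1 - α - β) * x) with hB | hB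
  · exact hΓ.le_max hα hβ₀ hαβ hx₀ hα₁.le hz hβ₀.le hB hp
  have hx₁ := mul_le_mul_of_nonneg_left hx hα₁.le
  have hlow : α * (1 - β) * (1 - α) ≤ (1 - α - β) * x := by
    linarith [mul_lt_mul_of_pos_left hA hα]
  have hdiff : (1 - α) * (z + (1 - β)) < β * x :=
    lt_of_mul_lt_mul_left (by linarith) hα.le
  have hβ₂ : β * β < 1 - β := by nlinarith
  refine hΓ.le_max_of_middle_le hα hβ₀ hαβ h₀ hx₀ hz hlow ?_ hp
  have hmid : (1 - α) * α * (z + β * β) ≤ (1 - β) * (β * x) := calc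
    (1 - α) * α * (z + β * β) ≤ (1 - α) * α * (z + (1 - β)) := by gcongr
    _ = α * ((1 - α) * (z + (1 - β))) := by ring
    _ ≤ (1 - β) * (β * x) := by
      gcongr
      linarith
  linarith

end IsSelfSimilar

/-! ### The region `Δ` -/

lemma mul_pow_lt_of_lt_e {α β : ℝ} {j : ℕ} (hα : 0 ≤ α) (hα₁ : α ≤ 1) (h : β < e j α) :
    (1 - α) * α ^ j < (1 - β) ^ (j + 1) * (1 + (1 - α) * α ^ j) := by
  have h₁ : 0 ≤ (1 - α) * α ^ j := mul_nonneg (sub_nonneg.2 hα₁) (by positivity)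
  have hpow : α ^ j - α ^ (j + 1) = (1 - α) * α ^ j := by ring
  rw [e, add_sub_assoc, hpow] at h
  set y := (1 - α) * α ^ j / (1 + (1 - α) * α ^ j) with hy
  have hy₀ : 0 ≤ y := by positivity
  have hroot : (y ^ ((1 : ℝ) / ((j : ℝ) + 1))) ^ (j + 1) = y := by
    have := Real.rpow_inv_natCast_pow hy₀ (Nat.succ_ne_zero j)
    rwa [Nat.cast_succ, inv_eq_one_div] at this
  have hlt : y < (1 - β) ^ (j + 1) := by
    rw [← hroot]
    exact pow_lt_pow_left₀ (by linarith) (Real.rpow_nonneg hy₀ _) (Nat.succ_ne_zero j)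
  rwa [hy, div_lt_iff₀ (by positivity)] at hlt

lemma pow_lt_of_mem_Delta {α β : ℝ} (h : (α, β) ∈ Delta) (m : ℕ) :
    α ^ m < (1 - β) ^ m * (α / (1 - α) + α ^ m) := by
  obtain ⟨⟨hα, hβ, hαβ⟩, he⟩ := h
  dsimp only at hα hβ hαβ he
  have hα₁ : 0 < 1 - α := by linarith
  cases m with
  | zero =>
    simp only [pow_zero, one_mul, lt_add_iff_pos_left]
    positivity
  | succ j =>
    have hj := mul_lt_mul_of_pos_left (mul_pow_lt_of_lt_e hα.le (by linarith) (he j))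
      (div_pos hα hα₁)
    have hcancel : α / (1 - α) * (1 - α) = α := div_mul_cancel₀ _ hα₁.ne'
    calc α ^ (j + 1) = α / (1 - α) * ((1 - α) * α ^ j) := by rw [← mul_assoc, hcancel, pow_succ']
      _ < _ := hj
      _ = (1 - β) ^ (j + 1) * (α / (1 - α) + α / (1 - α) * (1 - α) * α ^ j) := by ring
      _ = (1 - β) ^ (j + 1) * (α / (1 - α) + α ^ (j + 1)) := by rw [hcancel, ← pow_succ' α]

lemma mul_two_sub_lt_one_of_mem_Delta {α β : ℝ} (h : (α, β) ∈ Delta) : β * (2 - α) < 1 := by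
  obtain ⟨hα, hβ, hαβ⟩ := h.1
  dsimp only at hα hβ hαβ
  have hα₁ : 0 < 1 - α := by linarith
  have h1 := pow_lt_of_mem_Delta h 1
  rw [pow_one, pow_one, div_add' _ _ _ hα₁.ne', ← mul_div_assoc, lt_div_iff₀ hα₁] at h1
  exact lt_of_mul_lt_mul_left (by linarith) hα.le

/-- The `m`-th condition defining `Δ` rules out that a large pair leaves the star after `m` steps
inside it. -/
lemma IsSelfSimilar.mul_lt {α β : ℝ} {Γ : Set (ℝ × ℝ)} {p : ℝ × ℝ} (hΓ : IsSelfSimilar α β Γ)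
    (h : (α, β) ∈ Delta) (m : ℕ) (hp : p ∈ Γ) :
    (α / (1 - α) + α ^ m * (α + (1 - α) * p.1)) *
      (1 - (1 - β) ^ m + (1 - β) ^ m * (β * p.2)) < α / (1 - α) := by
  obtain ⟨hα, hβ, hαβ⟩ := h.1
  dsimp only at hα hβ hαβ
  have hα₁ : 0 < 1 - α := by linarith
  have hβ₁ : 0 < 1 - β := by linarith
  have hm := pow_lt_of_mem_Delta h m
  have hm' := pow_lt_of_mem_Delta h (m + 1)
  have hq₁ : (1 - β) ^ m ≤ 1 := pow_le_one₀ hβ₁.le (by linarith)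
  have hs : 0 < α / (1 - α) := by positivity
  have ht : 0 < α ^ m := by positivity
  have hq : 0 < (1 - β) ^ m := by positivity
  rw [pow_succ α, pow_succ (1 - β)] at hm'
  generalize α / (1 - α) = s at *
  generalize α ^ m = t at *
  generalize (1 - β) ^ m = q at *
  have hx : α * ((1 - q) / q + 1) ≤ (1 - β) * (s / t + α) := by
    rw [div_add_one hq.ne', sub_add_cancel, mul_one_div, div_le_iff₀ hq, div_add' _ _ _ ht.ne',
      ← mul_div_assoc, div_mul_eq_mul_div, le_div_iff₀ ht]
    linarith
  have key := hΓ.right_le_max hα hβ hαβ (mul_two_sub_lt_one_of_mem_Delta h)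
    (div_nonneg (sub_nonneg.2 hq₁) hq.le) hx hp
  calc (s + t * (α + (1 - α) * p.1)) * (1 - q + q * (β * p.2))
      = t * q * ((s / t + α + (1 - α) * p.1) * ((1 - q) / q + β * p.2)) := by
        field_simp
        ring
    _ ≤ t * q * max ((s / t + α) * ((1 - q) / q + β)) ((s / t + α + (1 - α)) * ((1 - q) / q)) := by
        gcongr
    _ < s := by
      rw [mul_max_of_nonneg _ _ (by positivity), max_lt_iff]
      constructor
      · calc _ = (s + α * t) * (1 - q + β * q) := by field_simp
          _ < s := by linarith
      · calc _ = (s + t) * (1 - q) := by field_simp; ring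
          _ < s := by linarith

/-! ### Ratios and densities -/

section Density

variable {ι : Type*} {F G : Filter ι} {N N' K K' L u u' v v' : ι → ℕ} {α β a a' b b' : ℝ}

/-- `N` tends to infinity and `K / N` tends to `α` along `F`. -/
structure HasRatio (F : Filter ι) (N K : ι → ℕ) (α : ℝ) : Prop where
  tendsto_atTop : Tendsto N F atTop
  tendsto_div : Tendsto (fun i => (K i : ℝ) / N i) F (𝓝 α)

/-- Among the `K`-subsets of an `N`-element set, families of size `u` have limiting density `a`
along `F`. -/
def HasDensity (F : Filter ι) (N K u : ι → ℕ) (a : ℝ) : Prop :=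
  Tendsto (fun i => (u i : ℝ) / (N i).choose (K i)) F (𝓝 a)

namespace HasRatio

lemma mono (h : HasRatio F N K α) (hGF : G ≤ F) : HasRatio G N K α :=
  ⟨h.tendsto_atTop.mono_left hGF, h.tendsto_div.mono_left hGF⟩

lemma tendsto_cast (h : HasRatio F N K α) : Tendsto (fun i => (N i : ℝ)) F atTop :=
  tendsto_natCast_atTop_atTop.comp h.tendsto_atTop

lemma zero (h : HasRatio F N K α) : HasRatio F N (fun _ => 0) 0 :=
  ⟨h.tendsto_atTop, by simpa using tendsto_const_nhds⟩

lemma self (h : HasRatio F N K α) : HasRatio F N N 1 := by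
  refine ⟨h.tendsto_atTop, tendsto_const_nhds.congr' ?_⟩
  filter_upwards [h.tendsto_atTop.eventually_ge_atTop 1] with i hi
  exact (div_self (by positivity)).symm

lemma add (hK : HasRatio F N K α) (hL : HasRatio F N L β) :
    HasRatio F N (fun i => K i + L i) (α + β) :=
  ⟨hK.tendsto_atTop, by simpa only [Nat.cast_add, add_div] using hK.tendsto_div.add hL.tendsto_div⟩

lemma eventually_add_le (hK : HasRatio F N K α) (hL : HasRatio F N L β) (h : α < β) (m : ℕ) :
    ∀ᶠ i in F, K i + m ≤ L i := by
  have hlim := (hL.tendsto_div.sub hK.tendsto_div).pos_mul_atTop (sub_pos.2 h) hK.tendsto_cast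
  filter_upwards [hlim.eventually_ge_atTop (m : ℝ), hK.tendsto_atTop.eventually_ge_atTop 1]
    with i hi hN
  rw [← sub_div, div_mul_cancel₀ _ (by positivity)] at hi
  have : (K i + m : ℝ) ≤ L i := by linarith
  exact_mod_cast this

lemma eventually_ge (hK : HasRatio F N K α) (hα : 0 < α) (m : ℕ) : ∀ᶠ i in F, m ≤ K i := by
  simpa only [zero_add] using hK.zero.eventually_add_le hK hα m

lemma eventually_add_add_le (hK : HasRatio F N K α) (hL : HasRatio F N L β) (h : α + β < 1)
    (m : ℕ) : ∀ᶠ i in F, K i + L i + m ≤ N i :=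
  (hK.add hL).eventually_add_le hK.self h m

lemma eventually_choose_pos (hK : HasRatio F N K α) (hα : α < 1) :
    ∀ᶠ i in F, 0 < (N i).choose (K i) := by
  filter_upwards [hK.eventually_add_le hK.self hα 0] with i hi
  exact Nat.choose_pos hi

lemma of_le_of_le_add (hK : HasRatio F N K α) (m : ℕ) (h₁ : ∀ i, K' i ≤ K i)
    (h₂ : ∀ i, K i ≤ K' i + m) : HasRatio F (fun i => N i - m) K' α := by
  have hN : Tendsto (fun i => N i - m) F atTop :=
    (tendsto_sub_atTop_nat m).comp hK.tendsto_atTop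
  have hm : Tendsto (fun i => (m : ℝ) / (N i - m : ℕ)) F (𝓝 0) :=
    tendsto_const_nhds.div_atTop (tendsto_natCast_atTop_atTop.comp hN)
  have hdiff : Tendsto (fun i => ((K i : ℝ) - K' i) / (N i - m : ℕ)) F (𝓝 0) := by
    refine squeeze_zero (fun i => ?_) (fun i => ?_) hm
    · exact div_nonneg (sub_nonneg.2 (by exact_mod_cast h₁ i)) (by positivity)
    · gcongr
      exact sub_le_iff_le_add'.2 (by exact_mod_cast h₂ i)
  have hlim := (hK.tendsto_div.mul (hm.const_add 1)).sub hdiff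
  rw [add_zero, mul_one, sub_zero] at hlim
  refine ⟨hN, hlim.congr' ?_⟩
  filter_upwards [hK.tendsto_atTop.eventually_ge_atTop (m + 1)] with i hi
  obtain ⟨M, hM⟩ := Nat.exists_eq_add_of_le' hi
  rw [hM, show M + (m + 1) - m = M + 1 by omega]
  push_cast
  field_simp
  ring

lemma sub (hK : HasRatio F N K α) (m : ℕ) : HasRatio F (fun i => N i - m) K α :=
  hK.of_le_of_le_add m (fun _ => le_rfl) fun _ => Nat.le_add_right _ _

lemma sub_sub (hK : HasRatio F N K α) (m : ℕ) :
    HasRatio F (fun i => N i - m) (fun i => K i - m) α :=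
  hK.of_le_of_le_add m (fun _ => Nat.sub_le _ _) fun _ => by omega

end HasRatio

lemma hasRatio_floor (hα : 0 ≤ α) : HasRatio atTop id (fun n : ℕ => ⌊α * (n : ℝ)⌋₊) α :=
  ⟨tendsto_id, (tendsto_nat_floor_mul_div_atTop hα).comp tendsto_natCast_atTop_atTop⟩

namespace HasDensity

lemma nonneg [F.NeBot] (hu : HasDensity F N K u a) : 0 ≤ a :=
  ge_of_tendsto' hu fun _ => by positivity

lemma add (hu : HasDensity F N K u a) (hv : HasDensity F N K v b) :
    HasDensity F N K (fun i => u i + v i) (a + b) := by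
  simpa only [HasDensity, Nat.cast_add, add_div] using Tendsto.add hu hv

lemma sub (hu : HasDensity F N K u a) (hv : HasDensity F N K v b) (h : ∀ᶠ i in F, v i ≤ u i) :
    HasDensity F N K (fun i => u i - v i) (a - b) := by
  refine Tendsto.congr' ?_ (Tendsto.sub hu hv)
  filter_upwards [h] with i hi
  rw [Nat.cast_sub hi, sub_div]

lemma trans (hC : HasDensity F N K (fun i => (N' i).choose (K' i)) b)
    (hpos : ∀ᶠ i in F, 0 < (N' i).choose (K' i)) (hu : HasDensity F N' K' u a) :
    HasDensity F N K u (b * a) := by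
  refine Tendsto.congr' ?_ (Tendsto.mul hC hu)
  filter_upwards [hpos] with i hi
  rw [mul_comm, div_mul_div_cancel₀ (by positivity)]

lemma eventually_mul_lt_mul (hu : HasDensity F N K u a) (hv : HasDensity F N L v b)
    (hu' : HasDensity F N K u' a') (hv' : HasDensity F N L v' b') (h : a * b < a' * b') :
    ∀ᶠ i in F, u i * v i < u' i * v' i := by
  filter_upwards [(Tendsto.mul hu hv).eventually_lt (Tendsto.mul hu' hv') h] with i hi
  rw [div_mul_div_comm, div_mul_div_comm] at hi
  rw [div_eq_mul_inv, div_eq_mul_inv] at hi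
  exact_mod_cast lt_of_mul_lt_mul_right hi (by positivity)

lemma mul_le_mul [F.NeBot] (hu : HasDensity F N K u a) (hv : HasDensity F N L v b)
    (hu' : HasDensity F N K u' a') (hv' : HasDensity F N L v' b')
    (h : ∀ᶠ i in F, u i * v i ≤ u' i * v' i) : a * b ≤ a' * b' := by
  by_contra! hlt
  obtain ⟨i, hi, hi'⟩ := (h.and (hu'.eventually_mul_lt_mul hv' hu hv hlt)).exists
  exact hi.not_gt hi'

lemma le_of_eventually_le [F.NeBot] (hu : HasDensity F N K u a) (hv : HasDensity F N K v b)
    (h : ∀ᶠ i in F, u i ≤ v i) : a ≤ b := by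
  refine le_of_tendsto_of_tendsto hu hv ?_
  filter_upwards [h] with i hi
  gcongr

end HasDensity

namespace HasRatio

lemma hasDensity_choose (hK : HasRatio F N K α) (hα : α < 1) :
    HasDensity F N K (fun i => (N i).choose (K i)) 1 := by
  refine tendsto_const_nhds.congr' ?_
  filter_upwards [hK.eventually_choose_pos hα] with i hi
  exact (div_self (by positivity)).symm

lemma hasDensity_choose_pred_pred (hK : HasRatio F N K α) (hα : 0 < α) (hα₁ : α < 1) :
    HasDensity F N K (fun i => (N i - 1).choose (K i - 1)) α := by
  refine hK.tendsto_div.congr' ?_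
  filter_upwards [hK.eventually_ge hα 1, hK.eventually_add_le hK.self hα₁ 0] with i hK₁ hKN
  obtain ⟨k, hk⟩ := Nat.exists_eq_add_of_le' hK₁
  obtain ⟨n, hn⟩ := Nat.exists_eq_add_of_le' (hK₁.trans hKN)
  have hpos := Nat.choose_pos hKN
  rw [hk, hn] at hpos ⊢
  rw [div_eq_div_iff (by positivity) (by positivity)]
  have hmul := Nat.add_one_mul_choose_eq n k
  simp only [Nat.add_sub_cancel]
  exact_mod_cast (by linarith)

lemma hasDensity_choose_pred (hK : HasRatio F N K α) (hα : 0 < α) (hα₁ : α < 1) :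
    HasDensity F N K (fun i => (N i - 1).choose (K i)) (1 - α) := by
  have hpascal : ∀ᶠ i in F,
      (N i).choose (K i) = (N i - 1).choose (K i - 1) + (N i - 1).choose (K i) := by
    filter_upwards [hK.eventually_ge hα 1, hK.self.eventually_ge one_pos 1] with i hK₁ hN₁
    exact Nat.choose_eq_choose_pred_add hN₁ hK₁
  refine Tendsto.congr' ?_ ((hK.hasDensity_choose hα₁).sub
    (hK.hasDensity_choose_pred_pred hα hα₁) (hpascal.mono fun i hi => hi ▸ Nat.le_add_right _ _))
  filter_upwards [hpascal] with i hi
  rw [hi, Nat.add_sub_cancel_left]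

lemma hasDensity_choose_sub_sub (hK : HasRatio F N K α) (hα : 0 < α) (hα₁ : α < 1) (m : ℕ) :
    HasDensity F N K (fun i => (N i - m).choose (K i - m)) (α ^ m) := by
  induction m with
  | zero => simpa using hK.hasDensity_choose hα₁
  | succ m ih =>
    exact ih.trans ((hK.sub_sub m).eventually_choose_pos hα₁)
      ((hK.sub_sub m).hasDensity_choose_pred_pred hα hα₁)

lemma hasDensity_choose_sub (hK : HasRatio F N K α) (hα : 0 < α) (hα₁ : α < 1) (m : ℕ) :
    HasDensity F N K (fun i => (N i - m).choose (K i)) ((1 - α) ^ m) := by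
  induction m with
  | zero => simpa using hK.hasDensity_choose hα₁
  | succ m ih =>
    exact ih.trans ((hK.sub m).eventually_choose_pos hα₁)
      ((hK.sub m).hasDensity_choose_pred hα hα₁)

lemma hasDensity_choose_pred_pred_pred (hK : HasRatio F N K α) (hα : 0 < α) (hα₁ : α < 1) :
    HasDensity F (fun i => N i - 1) K (fun i => (N i - 1).choose (K i - 1)) (α / (1 - α)) := by
  refine Tendsto.congr' ?_ (Tendsto.div (hK.hasDensity_choose_pred_pred hα hα₁)
    (hK.hasDensity_choose_pred hα hα₁) (sub_pos.2 hα₁).ne')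
  filter_upwards [hK.eventually_choose_pos hα₁] with i hi
  exact div_div_div_cancel_right₀ (by positivity) _ _

end HasRatio

end Density

/-! ### Limits of feasible sizes -/

section LimitSet

variable {ι : Type*} {U : Ultrafilter ι} {N K L u v : ι → ℕ} {α β a b : ℝ} {p : ℝ × ℝ}

lemma exists_hasDensity (h : ∀ᶠ i in (U : Filter ι), u i ≤ (N i).choose (K i)) :
    ∃ a, HasDensity U N K u a := by
  have hmem : ∀ᶠ i in (U : Filter ι), (u i : ℝ) / (N i).choose (K i) ∈ Set.Icc (0 : ℝ) 1 := by
    filter_upwards [h] with i hi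
    exact ⟨by positivity, div_le_one_of_le₀ (by exact_mod_cast hi) (by positivity)⟩
  obtain ⟨a, -, ha⟩ := isCompact_Icc.ultrafilter_le_nhds
    (U.map fun i => (u i : ℝ) / (N i).choose (K i)) (le_principal_iff.2 hmem)
  exact ⟨a, ha⟩

/-- The limits along `U` of the pairs of densities of feasible sizes, where the ratios of the set
sizes to the size of the ground set tend to `α` and `β`. Only these ratios are prescribed, so that
the set does not change when one point is removed from the ground set. -/
def limitSet (U : Ultrafilter ι) (α β : ℝ) : Set (ℝ × ℝ) :=
  {p | ∃ N K L u v : ι → ℕ, HasRatio U N K α ∧ HasRatio U N L β ∧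
    (∀ᶠ i in (U : Filter ι), Feasible (N i) (K i) (L i) (u i) (v i)) ∧
    HasDensity U N K u p.1 ∧ HasDensity U N L v p.2}

lemma swap_mem_limitSet (hp : p ∈ limitSet U α β) : p.swap ∈ limitSet U β α := by
  obtain ⟨N, K, L, u, v, hK, hL, hF, hu, hv⟩ := hp
  exact ⟨N, L, K, v, u, hL, hK, hF.mono fun i h => h.symm, hv, hu⟩

lemma exists_mem_limitSet (hK : HasRatio U N K α) (hL : HasRatio U N L β)
    (hF : ∀ᶠ i in (U : Filter ι), Feasible (N i) (K i) (L i) (u i) (v i)) :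
    ∃ p ∈ limitSet U α β, HasDensity U N K u p.1 ∧ HasDensity U N L v p.2 := by
  obtain ⟨a, ha⟩ := exists_hasDensity (hF.mono fun i h => h.left_le)
  obtain ⟨b, hb⟩ := exists_hasDensity (hF.mono fun i h => h.right_le)
  exact ⟨(a, b), ⟨N, K, L, u, v, hK, hL, hF, ha, hb⟩, ha, hb⟩

lemma exists_mem_limitSet_of_feasible_pred (hα : 0 < α) (hα₁ : α < 1) (hβ : 0 < β) (hβ₁ : β < 1)
    (hK : HasRatio U N K α) (hL : HasRatio U N L β) (hu : HasDensity U N K u a)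
    (hv : HasDensity U N L v b)
    (hF : ∀ᶠ i in (U : Filter ι), Feasible (N i - 1) (K i - 1) (L i) (u i)
      (v i - (N i - 1).choose (L i - 1))) :
    ∃ p ∈ limitSet U α β, a ≤ α * p.1 ∧ b ≤ β + (1 - β) * p.2 := by
  obtain ⟨p, hp, hu', hv'⟩ := exists_mem_limitSet (hK.sub_sub 1) (hL.sub 1) hF
  have hu₁ := (hK.hasDensity_choose_pred_pred hα hα₁).trans
    ((hK.sub_sub 1).eventually_choose_pos hα₁) hu'
  have hv₁ := (hL.hasDensity_choose_pred_pred hβ hβ₁).add ((hL.hasDensity_choose_pred hβ hβ₁).trans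
    ((hL.sub 1).eventually_choose_pos hβ₁) hv')
  exact ⟨p, hp, hu.le_of_eventually_le hu₁ (.of_forall fun _ => le_rfl),
    hv.le_of_eventually_le hv₁ (.of_forall fun _ => by omega)⟩

theorem isSelfSimilar_limitSet (hα : 0 < α) (hβ : 0 < β) (hαβ : α + β < 1) :
    IsSelfSimilar α β (limitSet U α β) where
  nonneg_left := fun _ ⟨_, _, _, _, _, _, _, _, hu, _⟩ => hu.nonneg
  nonneg_right := fun _ ⟨_, _, _, _, _, _, _, _, _, hv⟩ => hv.nonneg
  add_le_one := by
    rintro p ⟨N, K, L, u, v, hK, hL, hF, hu, hv⟩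
    refine le_of_tendsto (Tendsto.add hu hv) ?_
    filter_upwards [hF, hK.eventually_add_add_le hL hαβ 0] with i hi hle
    exact hi.div_choose_add_div_choose_le_one hle
  cover := by
    rintro p ⟨N, K, L, u, v, hK, hL, hF, hu, hv⟩
    have hα₁ : α < 1 := by linarith
    have hβ₁ : β < 1 := by linarith
    have hsplit : ∀ᶠ i in (U : Filter ι),
        Feasible (N i - 1) (K i - 1) (L i) (u i) (v i - (N i - 1).choose (L i - 1)) ∨
          Feasible (N i - 1) (K i) (L i - 1) (u i - (N i - 1).choose (K i - 1)) (v i) := by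
      filter_upwards [hF, hK.eventually_add_add_le hL hαβ 0, hK.eventually_ge hα 1,
        hL.eventually_ge hβ 1] with i hi hle hK₁ hL₁
      exact hi.split_pred hK₁ hL₁ hle
    rcases Ultrafilter.eventually_or.1 hsplit with h | h
    · obtain ⟨p', hp', hle⟩ := exists_mem_limitSet_of_feasible_pred hα hα₁ hβ hβ₁ hK hL hu hv h
      exact ⟨p', hp', .inl hle⟩
    · obtain ⟨p', hp', hle⟩ := exists_mem_limitSet_of_feasible_pred hβ hβ₁ hα hα₁ hL hK hv hu
        (h.mono fun i hi => hi.symm)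
      exact ⟨p'.swap, swap_mem_limitSet hp', .inr hle.symm⟩

end LimitSet

/-! ### First families larger than a star -/

lemma add_mul_lt_mul_of_mul_add_mul_le {S T X Y u v w : ℕ} (hu : 0 < u) (hv : v ≤ T)
    (hw : v + Y ≤ T + w) (h : u * Y + w * X ≤ X * Y) (hXT : X * T < S * Y) :
    (S + u) * v < S * T := by
  have hY : 0 < Y := Nat.pos_of_mul_pos_left (Nat.zero_lt_of_lt hXT)
  obtain ⟨d, rfl⟩ := Nat.exists_eq_add_of_le hv
  have hchord : u * Y ≤ X * d := by
    have hYd : X * Y ≤ X * (d + w) := Nat.mul_le_mul_left X (by omega)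
    linarith
  have hd : 0 < d := Nat.pos_of_mul_pos_left ((Nat.mul_pos hu hY).trans_le hchord)
  refine Nat.lt_of_mul_lt_mul_left (a := Y) ?_
  calc Y * ((S + u) * v) = S * Y * v + u * Y * v := by ring
    _ ≤ S * Y * v + X * d * (v + d) := by gcongr
    _ = S * Y * v + X * (v + d) * d := by ring
    _ < S * Y * v + S * Y * d := by gcongr
    _ = Y * (S * (v + d)) := by ring

section LargeFirst

variable {ι : Type*} {U : Ultrafilter ι} {α β : ℝ} {N K L S u v : ι → ℕ}

/-- A pair whose first family exceeds a star of size `S` by `u` cannot leave the link branch after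
`m` steps, since its product would be too small by `IsSelfSimilar.mul_lt`. -/
lemma not_eventually_feasible_branch (hΔ : (α, β) ∈ Delta) (hK : HasRatio U N K α)
    (hL : HasRatio U N L β) (hS : HasDensity U N K S (α / (1 - α)))
    (hprod : ∀ᶠ i in (U : Filter ι), S i * (N i).choose (L i) ≤ (S i + u i) * v i) (m : ℕ) :
    ¬ ∀ᶠ i in (U : Filter ι), Feasible (N i - m - 1) (K i - m) (L i - 1)
      (u i - (N i - m - 1).choose (K i - m - 1))
      (v i + (N i - m).choose (L i) - (N i).choose (L i)) := by
  intro hF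
  obtain ⟨hα, hβ, hαβ⟩ := hΔ.1
  dsimp only at hα hβ hαβ
  have hα₁ : α < 1 := by linarith
  have hβ₀ : 0 < β := by linarith
  have hβ₁ : β < 1 := by linarith
  have hKm := hK.sub_sub m
  have hLm := hL.sub m
  obtain ⟨p, hp, hu', hv'⟩ := exists_mem_limitSet (hKm.sub 1) (hLm.sub_sub 1) hF
  have hu := hS.add ((hK.hasDensity_choose_sub_sub hα hα₁ m).trans (hKm.eventually_choose_pos hα₁)
    ((hKm.hasDensity_choose_pred_pred hα hα₁).add ((hKm.hasDensity_choose_pred hα hα₁).trans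
      ((hKm.sub 1).eventually_choose_pos hα₁) hu')))
  have hv := ((hL.hasDensity_choose hβ₁).sub (hL.hasDensity_choose_sub hβ₀ hβ₁ m)
    (.of_forall fun i => Nat.choose_le_choose _ (Nat.sub_le _ _))).add
    ((hL.hasDensity_choose_sub hβ₀ hβ₁ m).trans (hLm.eventually_choose_pos hβ₁)
      ((hLm.hasDensity_choose_pred_pred hβ₀ hβ₁).trans
        ((hLm.sub_sub 1).eventually_choose_pos hβ₁) hv'))
  have hle := hS.mul_le_mul (hL.hasDensity_choose hβ₁) hu hv <| by
    filter_upwards [hprod] with i hi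
    exact hi.trans (Nat.mul_le_mul (by omega) (by omega))
  have hlt := (isSelfSimilar_limitSet hα hβ₀ hαβ).mul_lt hΔ m hp
  linarith

lemma eventually_feasible_sub (hΔ : (α, β) ∈ Delta) (hK : HasRatio U N K α)
    (hL : HasRatio U N L β) (hS : HasDensity U N K S (α / (1 - α)))
    (hF : ∀ᶠ i in (U : Filter ι), Feasible (N i) (K i) (L i) (u i) (v i))
    (hprod : ∀ᶠ i in (U : Filter ι), S i * (N i).choose (L i) ≤ (S i + u i) * v i) (m : ℕ) :
    ∀ᶠ i in (U : Filter ι), Feasible (N i - m) (K i - m) (L i) (u i)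
      (v i + (N i - m).choose (L i) - (N i).choose (L i)) := by
  obtain ⟨hα, hβ, hαβ⟩ := hΔ.1
  dsimp only at hα hβ hαβ
  have hβ₀ : 0 < β := by linarith
  induction m with
  | zero => simpa using hF
  | succ m ih =>
    have hsplit : ∀ᶠ i in (U : Filter ι),
        Feasible (N i - (m + 1)) (K i - (m + 1)) (L i) (u i)
          (v i + (N i - (m + 1)).choose (L i) - (N i).choose (L i)) ∨
        Feasible (N i - m - 1) (K i - m) (L i - 1) (u i - (N i - m - 1).choose (K i - m - 1))
          (v i + (N i - m).choose (L i) - (N i).choose (L i)) := by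
      filter_upwards [ih, (hK.sub_sub m).eventually_add_add_le (hL.sub m) hαβ 0,
        (hK.sub_sub m).eventually_ge hα 1, hL.eventually_ge hβ₀ 1] with i hi hle hK₁ hL₁
      refine (hi.split_pred hK₁ hL₁ hle).imp_left fun h => ?_
      have hpascal := Nat.choose_eq_choose_pred_add (show 0 < N i - m by omega) hL₁
      rw [← Nat.sub_sub, ← Nat.sub_sub]
      convert h using 1
      omega
    exact (Ultrafilter.eventually_or.1 hsplit).resolve_right
      (not_eventually_feasible_branch hΔ hK hL hS hprod m)

theorem not_eventually_mul_choose_le (hΔ : (α, β) ∈ Delta) (hK : HasRatio U N K α)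
    (hL : HasRatio U N L β) (hS : HasDensity U N K S (α / (1 - α)))
    (hF : ∀ᶠ i in (U : Filter ι), Feasible (N i) (K i) (L i) (u i) (v i))
    (hu : ∀ᶠ i in (U : Filter ι), 0 < u i) :
    ¬ ∀ᶠ i in (U : Filter ι), S i * (N i).choose (L i) ≤ (S i + u i) * v i := by
  intro hprod
  obtain ⟨hα, hβ, hαβ⟩ := hΔ.1
  dsimp only at hα hβ hαβ
  have hα₁ : 0 < 1 - α := by linarith
  have hβ₁ : 0 < 1 - β := by linarith
  obtain ⟨m, hm⟩ : ∃ m : ℕ, α ^ m * 1 < α / (1 - α) * (1 - β) ^ m := by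
    obtain ⟨m, hm⟩ := exists_pow_lt_of_lt_one (x := α / (1 - α)) (y := α / (1 - β))
      (by positivity) ((div_lt_one hβ₁).2 (by linarith))
    refine ⟨m, ?_⟩
    rwa [div_pow, div_lt_iff₀ (by positivity), ← mul_one (α ^ m)] at hm
  have hXT := (hK.hasDensity_choose_sub_sub hα (by linarith) m).eventually_mul_lt_mul
    (hL.hasDensity_choose (by linarith)) hS
    (hL.hasDensity_choose_sub (by linarith) (by linarith) m) hm
  have hlt : ∀ᶠ i in (U : Filter ι), (S i + u i) * v i < S i * (N i).choose (L i) := by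
    filter_upwards [hF, hu, hXT, eventually_feasible_sub hΔ hK hL hS hF hprod m,
      (hK.sub_sub m).eventually_add_add_le (hL.sub m) hαβ 0] with i hFi hui hXTi hFm hle
    exact add_mul_lt_mul_of_mul_add_mul_le hui hFi.right_le (by omega)
      (hFm.mul_choose_add_mul_choose_le hle) hXTi
  obtain ⟨i, hi, hi'⟩ := (hlt.and hprod).exists
  exact hi.not_ge hi'

end LargeFirst

theorem eventually_mul_lt_of_choose_lt {ι : Type*} {F : Filter ι} {N K L : ι → ℕ} {α β : ℝ}
    (hΔ : (α, β) ∈ Delta) (hK : HasRatio F N K α) (hL : HasRatio F N L β) :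
    ∀ᶠ i in F, ∀ u v, Feasible (N i) (K i) (L i) u v → (N i - 1).choose (K i - 1) < u →
      u * v < (N i - 1).choose (K i - 1) * (N i - 1).choose (L i - 1) := by
  obtain ⟨hα, hβ, hαβ⟩ := hΔ.1
  dsimp only at hα hβ hαβ
  refine mem_iff_ultrafilter.2 fun U hU => ?_
  by_contra hcon
  replace hK := hK.mono hU
  replace hL := hL.mono hU
  have hlarge : ∀ᶠ i in (U : Filter ι), ∃ u v, Feasible (N i) (K i) (L i) u v ∧
      (N i - 1).choose (K i - 1) < u ∧
      (N i - 1).choose (K i - 1) * (N i - 1).choose (L i - 1) ≤ u * v := by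
    filter_upwards [Ultrafilter.compl_mem_iff_notMem.2 hcon] with i hi
    simpa using hi
  obtain ⟨u, hu⟩ := hlarge.choice
  obtain ⟨v, hv⟩ := hu.choice
  have hF : ∀ᶠ i in (U : Filter ι), Feasible (N i - 1) (K i) (L i - 1)
      (u i - (N i - 1).choose (K i - 1)) (v i) := by
    filter_upwards [hv, hK.eventually_add_add_le hL hαβ 0, hK.eventually_ge hα 1,
      hL.eventually_ge (by linarith) 1] with i ⟨hi, hlt, _⟩ hle hK₁ hL₁
    exact (hi.split_pred hK₁ hL₁ hle).resolve_left fun h => hlt.not_ge h.left_le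
  refine not_eventually_mul_choose_le hΔ (hK.sub 1) (hL.sub_sub 1)
    (hK.hasDensity_choose_pred_pred_pred hα (by linarith)) hF
    (hv.mono fun i hi => Nat.sub_pos_of_lt hi.2.1) (hv.mono fun i hi => ?_)
  rw [Nat.add_sub_cancel' hi.2.1.le]
  exact hi.2.2

end CrossIntersecting

open CrossIntersecting Filter

theorem theorem2_general {ι : Type*} {F : Filter ι} {N K L : ι → ℕ} {α β : ℝ}
    (h : (α, β) ∈ Delta) (hK : HasRatio F N K α) (hL : HasRatio F N L β) :
    ∀ᶠ i in F,
      IsGreatest (crossProducts (N i) (K i) (L i))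
        ((N i - 1).choose (K i - 1) * (N i - 1).choose (L i - 1)) ∧
      ∀ A B : Finset (Finset (Fin (N i))), IsCrossPair (N i) (K i) (L i) A B →
        A.card * B.card = (N i - 1).choose (K i - 1) * (N i - 1).choose (L i - 1) →
        ∃ j, A = star (N i) (K i) j ∧ B = star (N i) (L i) j := by
  obtain ⟨hα, hβ, hαβ⟩ := h.1
  dsimp only at hα hβ hαβ
  filter_upwards [eventually_mul_lt_of_choose_lt h hK hL, hK.eventually_ge hα 2,
    hL.eventually_ge (by linarith) 2, hK.eventually_add_add_le hL hαβ 1,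
    hL.self.eventually_add_le (hL.add hL) (by linarith) 1] with i hlarge hk hl hkl hn
  exact isGreatest_crossProducts_and_eq_star hk hl hkl (by omega) hlarge

theorem theorem2 (α β : ℝ) (h : (α, β) ∈ CrossIntersecting.Delta) :
    ∃ n₀ : ℕ, ∀ n : ℕ, n₀ < n → ∀ k l : ℕ, k = ⌊α * (n : ℝ)⌋₊ → l = ⌊β * (n : ℝ)⌋₊ →
      IsGreatest (CrossIntersecting.crossProducts n k l)
        ((n - 1).choose (k - 1) * (n - 1).choose (l - 1)) ∧
      ∀ A B : Finset (Finset (Fin n)), CrossIntersecting.IsCrossPair n k l A B →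
        A.card * B.card = (n - 1).choose (k - 1) * (n - 1).choose (l - 1) →
        ∃ i : Fin n, A = CrossIntersecting.star n k i ∧ B = CrossIntersecting.star n l i := by
  obtain ⟨hα, hβ, -⟩ := h.1
  dsimp only at hα hβ
  obtain ⟨n₀, hn₀⟩ := eventually_atTop.1
    (theorem2_general h (hasRatio_floor hα.le) (hasRatio_floor (by linarith)))
  refine ⟨n₀, fun n hn k l hk hl => ?_⟩
  subst hk hl
  exact hn₀ n hn.le
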